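/- Let $p$ be a prime number and let $a\in\mathbb{Z}$ be such that $f(x)=x^p-a$ is irreducible in $\mathbb{Z}[x]$. For $n\ge 1$ let $f^n=f\circ f\circ\cdots\circ f$ ($n$ times) denote the $n$-fold composition of $f$ with itself. Fix an integer $N\ge 1$. For each integer $n$ with $1\le n\le N$ let $\alpha_n$ be any root of $f^n(x)$ in a fixed field of characteristic zero (for example in $\mathbb{C}$), put $K_n=\mathbb{Q}(\alpha_n)$, and let $\mathcal{O}_{K_n}$ denote the ring of integers of $K_n$. Then the following are equivalent: (i) $\mathcal{O}_{K_n}=\mathbb{Z}[\alpha_n]$ for all integers $n$ with $1\le n\le N$; (ii) $a^p\not\equiv a \pmod{p^2}$, and the integer $f^n(0)$ is squarefree for all integers $n$ with $1\le n\le N$. -/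

import Mathlib

open Polynomial IntermediateField

/-- The polynomial `x ^ p - a` over the integers. -/
noncomputable def radicalPoly (p : ℕ) (a : ℤ) : ℤ[X] := X ^ p - C a

/-- The `n`-fold composition `f ∘ f ∘ ⋯ ∘ f` of a polynomial with itself
(for `n = 0` it is the identity polynomial `X`). -/
noncomputable def polyIterate (f : ℤ[X]) (n : ℕ) : ℤ[X] := f.comp^[n] X

/-- For an element `x` of a field `L` of characteristic zero: the ring of integers of `ℚ(x)`
(the integral closure of `ℤ` in `ℚ(x)`) equals `ℤ[x]`, as subrings of `ℚ(x)`. -/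
def IsMonogenerator {L : Type*} [Field L] [CharZero L] (x : L) : Prop :=
  integralClosure ℤ ℚ⟮x⟯ = Algebra.adjoin ℤ {AdjoinSimple.gen ℚ x}

/-! Integral closedness of `ℤ[α_n]` is tested at each maximal ideal `m`, over a prime `q`: a
singular point needs `f^n` to have a multiple root there and `q ∉ m²` locally. If `q = p`, then `y =
f^(n-1)(α_n)` satisfies `y^p = a`, and `(y-a)^p` is `p` times a local unit once `p² ∤ a^p - a`. If
`q ≠ p`, a multiple root puts some `f^i(α_n)`, `i < n`, in `m`; as `f^(n-i)` has no linear term,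
`f^(n-i)(0) ∈ m²`, and squarefreeness makes `q` a local multiple of it. Conversely, each failure of
(ii) yields an explicit integral quotient `b(α_n)/d` outside `ℤ[α_n]`, quadratic over that ring.
Irreducibility of `f^n` comes from Eisenstein at `p`. -/

/-! ### Dedekind's criterion for `ℤ[α]` -/

/-- An ideal of `ℤ[X]` is generated modulo a prime `q` by one of its elements. -/
theorem exists_generator_mod_prime (q : ℕ) (hq : q.Prime) (P : Ideal ℤ[X]) :
    ∃ g ∈ P, ∀ h ∈ P, ∃ k l, h = g * k + C (q : ℤ) * l := by
  have : Fact q.Prime := ⟨hq⟩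
  have hsurj : Function.Surjective (mapRingHom (Int.castRingHom (ZMod q))) :=
    map_surjective _ (ZMod.intCast_surjective)
  obtain ⟨g', hg'⟩ := (IsPrincipalIdealRing.principal
    (P.map (mapRingHom (Int.castRingHom (ZMod q))))).principal
  have hmem : g' ∈ P.map (mapRingHom (Int.castRingHom (ZMod q))) := by
    rw [hg']; exact Submodule.mem_span_singleton_self _
  obtain ⟨g, hgP, rfl⟩ := (Ideal.mem_map_iff_of_surjective _ hsurj).1 hmem
  refine ⟨g, hgP, fun h hh => ?_⟩
  have h1 := Ideal.mem_map_of_mem (mapRingHom (Int.castRingHom (ZMod q))) hh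
  rw [hg'] at h1
  obtain ⟨k', hk'⟩ := Ideal.mem_span_singleton'.1 h1
  obtain ⟨k, rfl⟩ := hsurj k'
  have h2 : mapRingHom (Int.castRingHom (ZMod q)) (h - g * k) = 0 := by
    rw [map_sub, map_mul, ← hk', mul_comm, sub_self]
  have h3 : C (q : ℤ) ∣ h - g * k := by
    rw [C_dvd_iff_dvd_coeff]
    intro i
    have h4 := congrArg (fun r => coeff r i) h2
    simp only [coe_mapRingHom, coeff_map, coeff_zero, eq_intCast] at h4
    exact (ZMod.intCast_zmod_eq_zero_iff_dvd _ _).1 h4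
  obtain ⟨l, hl⟩ := h3
  exact ⟨k, l, by rw [← hl]; ring⟩

theorem exists_prime_natCast_mem {A : Type*} [CommRing A] [Algebra.IsIntegral ℤ A]
    (m : Ideal A) [m.IsMaximal] : ∃ q : ℕ, q.Prime ∧ (q : A) ∈ m := by
  have hmax : (m.comap (algebraMap ℤ A)).IsMaximal :=
    Ideal.isMaximal_comap_of_isIntegral_of_isMaximal m
  have hne : m.comap (algebraMap ℤ A) ≠ ⊥ :=
    Ring.ne_bot_of_isMaximal_of_not_isField hmax Int.not_isField
  obtain ⟨g, hg⟩ := (IsPrincipalIdealRing.principal (m.comap (algebraMap ℤ A))).principal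
  have hg' : m.comap (algebraMap ℤ A) = Ideal.span {g} := hg
  have hg0 : g ≠ 0 := by
    rintro rfl
    exact hne (by rw [hg']; simp)
  have hp : Prime g := by
    rw [← Ideal.span_singleton_prime hg0, ← hg']
    exact hmax.isPrime
  refine ⟨g.natAbs, Int.prime_iff_natAbs_prime.1 hp, ?_⟩
  have h1 : (g.natAbs : ℤ) ∈ m.comap (algebraMap ℤ A) := by
    rw [hg', Ideal.mem_span_singleton]
    exact Int.dvd_natAbs_self
  rw [Ideal.mem_comap, algebraMap_int_eq, eq_intCast, Int.cast_natCast] at h1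
  exact h1

theorem natCast_dvd_of_intCast_mem {A : Type*} [CommRing A] {m : Ideal A} (hm : m ≠ ⊤)
    {q : ℕ} (hq : q.Prime) (hqm : (q : A) ∈ m) {z : ℤ} (hz : (z : A) ∈ m) : (q : ℤ) ∣ z := by
  by_contra h
  obtain ⟨u, v, huv⟩ := ((Nat.prime_iff_prime_int.1 hq).irreducible.coprime_iff_not_dvd).2 h
  apply hm
  rw [Ideal.eq_top_iff_one]
  have h1 : (1 : A) = u * q + v * z := by exact_mod_cast congrArg (Int.cast : ℤ → A) huv.symm
  rw [h1]
  exact m.add_mem (m.mul_mem_left _ hqm) (m.mul_mem_left _ hz)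

-- Here `m = (g(α), q)`. At a simple root `q` alone generates locally; if `q ∈ m²` locally, `g(α)`
-- does.
open IsLocalRing in
theorem isPrincipal_maximalIdeal_localization {A : Type*} [CommRing A] [IsNoetherianRing A]
    (α : A) (hα : Function.Surjective (aeval (R := ℤ) α)) (F : ℤ[X]) (hF : aeval α F = 0)
    (m : Ideal A) [m.IsMaximal] (q : ℕ) (hq : q.Prime)
    (h : aeval α (derivative F) ∉ m ∨ ∃ s ∉ m, s * (q : A) ∈ m ^ 2) (hqm : (q : A) ∈ m) :
    (maximalIdeal (Localization.AtPrime m)).IsPrincipal := by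
  obtain ⟨g, hgP, hg⟩ := exists_generator_mod_prime q hq (m.comap (aeval (R := ℤ) α))
  have hgm : aeval α g ∈ m := hgP
  set R := Localization.AtPrime m
  have hmap : m.map (algebraMap A R) = maximalIdeal R := IsLocalization.AtPrime.map_eq_maximalIdeal m R
  have hunit : ∀ s ∉ m, IsUnit (algebraMap A R s) := fun s hs =>
    IsLocalization.map_units R (⟨s, hs⟩ : m.primeCompl)
  have hgen : ∀ x ∈ m, ∃ k l, x = aeval α g * k + q * l := by
    intro x hx
    obtain ⟨y, rfl⟩ := hα x
    obtain ⟨k, l, hkl⟩ := hg y hx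
    exact ⟨aeval α k, aeval α l, by rw [hkl]; simp⟩
  rcases h with h | ⟨s, hs, hsq⟩
  · obtain ⟨k, l, hkl⟩ := hg F (by simp [Ideal.mem_comap, hF])
    -- In `F' = g'k + gk' + ql'` the last two terms lie in `m` at `α`, so `k(α) ∈ m` would force
    -- `F'(α) ∈ m`.
    have hk : aeval α k ∉ m := by
      intro hk
      apply h
      rw [hkl]
      simp only [derivative_mul, derivative_C, map_add, map_mul, zero_mul, zero_add, aeval_C]
      refine m.add_mem (m.add_mem (m.mul_mem_left _ hk) (m.mul_mem_right _ hgm)) ?_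
      exact m.mul_mem_right _ (by simpa using hqm)
    have hrel : aeval α k * aeval α g = q * -aeval α l := by
      have := hF
      rw [hkl] at this
      simp only [map_add, map_mul, map_natCast] at this
      linear_combination this
    have hgq : algebraMap A R (q : A) ∣ algebraMap A R (aeval α g) := by
      rw [← (hunit _ hk).dvd_mul_left, ← map_mul, hrel, map_mul]
      exact dvd_mul_right _ _
    refine ⟨⟨algebraMap A R (q : A), le_antisymm ?_ ?_⟩⟩
    · rw [← hmap, Ideal.map_le_iff_le_comap]
      intro x hx
      obtain ⟨k, l, rfl⟩ := hgen x hx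
      rw [Ideal.mem_comap, Ideal.submodule_span_eq, Ideal.mem_span_singleton, map_add, map_mul,
        map_mul]
      exact dvd_add (hgq.mul_right _) (dvd_mul_right _ _)
    · rw [Ideal.submodule_span_eq, Ideal.span_singleton_le_iff_mem, ← hmap]
      exact Ideal.mem_map_of_mem _ hqm
  · have hq2 : algebraMap A R (q : A) ∈ maximalIdeal R ^ 2 := by
      have h1 := Ideal.mem_map_of_mem (algebraMap A R) hsq
      rw [Ideal.map_pow, hmap, map_mul] at h1
      exact (Ideal.unit_mul_mem_iff_mem _ (hunit s hs)).1 h1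
    refine ⟨⟨algebraMap A R (aeval α g), le_antisymm ?_ ?_⟩⟩
    -- Nakayama, from `m ≤ (g(α)) + m²`.
    · refine Submodule.le_of_le_smul_of_le_jacobson_bot (I := maximalIdeal R)
        (IsNoetherian.noetherian _) (IsLocalRing.jacobson_eq_maximalIdeal _ bot_ne_top).ge ?_
      conv_lhs => rw [← hmap]
      rw [Ideal.map_le_iff_le_comap, smul_eq_mul, ← pow_two]
      intro x hx
      obtain ⟨k, l, rfl⟩ := hgen x hx
      rw [Ideal.mem_comap, map_add, map_mul, map_mul]
      refine Submodule.add_mem_sup ?_ (Ideal.mul_mem_right _ _ hq2)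
      exact Ideal.mul_mem_right _ _ (Submodule.mem_span_singleton_self _)
    · rw [Ideal.submodule_span_eq, Ideal.span_singleton_le_iff_mem, ← hmap]
      exact Ideal.mem_map_of_mem _ hgm

/-- A form of Dedekind's criterion: the order `ℤ[α]` is integrally closed if at every maximal ideal
over a prime `q` either `α` is a simple root of `F`, or `q` lies in the square of the ideal
locally. -/
theorem isIntegrallyClosed_of_simple_root_or_mem_sq {A : Type*} [CommRing A] [IsDomain A]
    [Algebra.IsIntegral ℤ A]
    (α : A) (hα : Function.Surjective (aeval (R := ℤ) α)) (F : ℤ[X]) (hF : aeval α F = 0)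
    (h : ∀ (m : Ideal A) [m.IsMaximal] (q : ℕ), q.Prime → (q : A) ∈ m →
      aeval α (derivative F) ∉ m ∨ ∃ s ∉ m, s * (q : A) ∈ m ^ 2) :
    IsIntegrallyClosed A := by
  have : IsNoetherianRing A := isNoetherianRing_of_surjective ℤ[X] A (aeval (R := ℤ) α).toRingHom hα
  refine IsIntegrallyClosed.of_localization_maximal fun m _ _ => ?_
  obtain ⟨q, hq, hqm⟩ := exists_prime_natCast_mem m
  have h1 := isPrincipal_maximalIdeal_localization α hα F hF m q hq (h m q hq hqm) hqm
  -- Item 4 is principality of the maximal ideal; item 3 contains integral closedness.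
  have h2 := (tfae_of_isNoetherianRing_of_isLocalRing_of_isDomain (Localization.AtPrime m)).out 4 3
  exact (h2.1 h1).1

/-- An integrally closed order `ℤ[x]` is the full ring of integers of `ℚ(x)`. -/
theorem isMonogenerator_of_isIntegrallyClosed {L : Type*} [Field L] [CharZero L] (x : L)
    (hx : IsIntegral ℤ x)
    (h : IsIntegrallyClosed (Algebra.adjoin ℤ {AdjoinSimple.gen ℚ x})) : IsMonogenerator x := by
  set g := AdjoinSimple.gen ℚ x with hgdef
  have hg : IsIntegral ℤ g := by
    rwa [← isIntegral_algebraMap_iff (B := L) (algebraMap ℚ⟮x⟯ L).injective,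
      AdjoinSimple.algebraMap_gen]
  have hden : ∀ r : ℚ[X], ∃ (b : ℤ) (G : ℤ[X]), b ≠ 0 ∧ (b : ℚ⟮x⟯) * aeval g r = aeval g G := by
    intro r
    obtain ⟨b, hb0, hb⟩ := IsLocalization.integerNormalization_spec (nonZeroDivisors ℤ) r
    refine ⟨b, IsLocalization.integerNormalization (nonZeroDivisors ℤ) r,
      nonZeroDivisors.ne_zero hb0, ?_⟩
    rw [← aeval_map_algebraMap ℚ g (IsLocalization.integerNormalization (nonZeroDivisors ℤ) r), hb]
    simp [zsmul_eq_mul]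
  have hmemA : ∀ G : ℤ[X], aeval g G ∈ Algebra.adjoin ℤ {g} := fun G => by
    rw [Algebra.adjoin_singleton_eq_range_aeval]; exact ⟨G, rfl⟩
  have : IsFractionRing (Algebra.adjoin ℤ {g}) ℚ⟮x⟯ := by
    refine IsFractionRing.of_field _ _ fun z => ?_
    obtain ⟨r, s, hrs⟩ := (IntermediateField.mem_adjoin_simple_iff ℚ (z : L)).1 z.2
    obtain ⟨b, G, hb, hG⟩ := hden r
    obtain ⟨c, H, hc, hH⟩ := hden s
    refine ⟨⟨(c : ℚ⟮x⟯) * aeval g G, mul_mem (intCast_mem _ c) (hmemA G)⟩,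
      ⟨(b : ℚ⟮x⟯) * aeval g H, mul_mem (intCast_mem _ b) (hmemA H)⟩, ?_⟩
    have hz : z = aeval g r / aeval g s := by
      apply (algebraMap ℚ⟮x⟯ L).injective
      rw [map_div₀, ← aeval_algebraMap_apply, ← aeval_algebraMap_apply, AdjoinSimple.algebraMap_gen]
      exact hrs
    have hb' : (b : ℚ⟮x⟯) ≠ 0 := Int.cast_ne_zero.2 hb
    have hc' : (c : ℚ⟮x⟯) ≠ 0 := Int.cast_ne_zero.2 hc
    change z = ((c : ℚ⟮x⟯) * aeval g G) / ((b : ℚ⟮x⟯) * aeval g H)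
    rw [hz, ← hG, ← hH, ← mul_assoc, ← mul_assoc, mul_comm (c : ℚ⟮x⟯) b,
      mul_div_mul_left _ _ (mul_ne_zero hb' hc')]
  unfold IsMonogenerator
  apply le_antisymm
  · intro y hy
    obtain ⟨z, hz⟩ := (isIntegrallyClosed_iff ℚ⟮x⟯).1 h
      (IsIntegral.tower_top (A := Algebra.adjoin ℤ {g}) (hy : IsIntegral ℤ y))
    rw [← hz]
    exact z.2
  · rw [Algebra.adjoin_le_iff, Set.singleton_subset_iff]
    exact hg

theorem isIntegral_adjoin_gen {L : Type*} [Field L] [CharZero L] (x : L)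
    (hx : IsIntegral ℤ x) : Algebra.IsIntegral ℤ (Algebra.adjoin ℤ {AdjoinSimple.gen ℚ x}) := by
  have hg : IsIntegral ℤ (AdjoinSimple.gen ℚ x) := by
    rwa [← isIntegral_algebraMap_iff (B := L) (algebraMap ℚ⟮x⟯ L).injective,
      AdjoinSimple.algebraMap_gen]
  exact Algebra.IsIntegral.adjoin (by simpa using hg)

/-! ### A test for failure of monogenicity -/

theorem eq_zero_of_aeval_eq_zero_of_degree_lt {K : Type*} [Field K] [CharZero K] {x : K}
    {F G : ℤ[X]} (hmon : F.Monic) (hirr : Irreducible F) (hF : aeval x F = 0) (hG : aeval x G = 0)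
    (hdeg : G.degree < F.degree) : G = 0 := by
  have hx : IsIntegral ℤ x := ⟨F, hmon, hF⟩
  have h1 : minpoly ℤ x ∣ F := minpoly.isIntegrallyClosed_dvd hx hF
  have h2 : F = minpoly ℤ x := by
    refine eq_of_monic_of_associated hmon (minpoly.monic hx) ?_
    exact (Irreducible.associated_of_dvd (minpoly.irreducible hx) hirr h1).symm
  by_contra h0
  have h3 := minpoly.isIntegrallyClosed_dvd hx hG
  rw [← h2] at h3
  exact absurd (degree_le_of_dvd h3 h0) (not_le.2 hdeg)

/-- If a monic polynomial `b` of degree less than `F` has `b(x) / m` satisfying a monic quadratic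
equation over `ℤ[x]`, then `ℤ[x]` is not integrally closed. -/
theorem not_isMonogenerator_of_quadratic {L : Type*} [Field L] [CharZero L] {x : L}
    {F b u v : ℤ[X]} {m : ℤ} (hmon : F.Monic) (hirr : Irreducible F) (hF : aeval x F = 0)
    (hb : b.Monic) (hbF : b.degree < F.degree) (hm : ¬ IsUnit m)
    (hq : aeval x (b ^ 2) = aeval x (C m * b * u + C m ^ 2 * v)) : ¬ IsMonogenerator x := by
  intro hmono
  set g := AdjoinSimple.gen ℚ x
  have hgx : ∀ G : ℤ[X], aeval x G = algebraMap ℚ⟮x⟯ L (aeval g G) := fun G => by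
    rw [← aeval_algebraMap_apply, AdjoinSimple.algebraMap_gen]
  have hFg : aeval g F = 0 := by
    apply (algebraMap ℚ⟮x⟯ L).injective
    rw [← hgx, hF, map_zero]
  have hqg : aeval g (b ^ 2) = aeval g (C m * b * u + C m ^ 2 * v) := by
    apply (algebraMap ℚ⟮x⟯ L).injective
    rw [← hgx, ← hgx, hq]
  simp only [map_pow, map_add, map_mul, eq_intCast, map_intCast] at hqg
  -- Reducing `G` modulo `F` turns equality at `g` into equality of polynomials; the leading
  -- coefficient of `b` then gives `m ∣ 1`.
  have key : ∀ G : ℤ[X], (m : ℚ⟮x⟯) * aeval g G ≠ aeval g b := by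
    intro G hG
    have h0 : C m * (G %ₘ F) - b = 0 := by
      refine eq_zero_of_aeval_eq_zero_of_degree_lt hmon hirr hFg ?_ ?_
      · rw [map_sub, map_mul, aeval_modByMonic_eq_self_of_root hFg, ← hG]
        simp
      · refine (degree_sub_le _ _).trans_lt (max_lt ?_ hbF)
        rw [C_mul']
        exact (degree_smul_le _ _).trans_lt (degree_modByMonic_lt _ hmon)
    have h1 := congrArg (fun r => coeff r b.natDegree) (sub_eq_zero.1 h0)
    simp only [coeff_C_mul, coeff_natDegree, hb.leadingCoeff] at h1
    exact hm (IsUnit.of_mul_eq_one _ h1)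
  by_cases hm0 : m = 0
  · apply key 0
    have : aeval g b ^ 2 = 0 := by rw [hqg, hm0]; simp
    rw [pow_eq_zero_iff two_ne_zero |>.1 this, hm0]
    simp
  have hm' : (m : ℚ⟮x⟯) ≠ 0 := Int.cast_ne_zero.2 hm0
  have hgint : IsIntegral ℤ g := ⟨F, hmon, hFg⟩
  have hint : ∀ G : ℤ[X], aeval g G ∈ integralClosure ℤ ℚ⟮x⟯ := fun G => by
    have : aeval g G ∈ Algebra.adjoin ℤ {g} := by
      rw [Algebra.adjoin_singleton_eq_range_aeval]; exact ⟨G, rfl⟩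
    exact hmono ▸ this
  have hβ : aeval g b / m ∈ integralClosure ℤ ℚ⟮x⟯ := by
    refine isIntegral_trans (A := integralClosure ℤ ℚ⟮x⟯) _ ?_
    refine ⟨X ^ 2 + (C ⟨-aeval g u, neg_mem (hint u)⟩ * X + C ⟨-aeval g v, neg_mem (hint v)⟩), ?_, ?_⟩
    · exact monic_X_pow_add (degree_linear_le.trans_lt (by norm_num))
    · simp only [eval₂_add, eval₂_mul, eval₂_pow, eval₂_X, eval₂_C]
      change (aeval g b / m) ^ 2 + (-aeval g u * (aeval g b / m) + -aeval g v) = 0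
      field_simp
      rw [hqg]
      ring
  rw [hmono, Algebra.adjoin_singleton_eq_range_aeval] at hβ
  obtain ⟨G, hG⟩ := hβ
  apply key G
  change aeval g G = _ at hG
  rw [hG, mul_div_cancel₀ _ hm']

/-! ### Iterates of `x^p - a` -/

theorem polyIterate_zero (f : ℤ[X]) : polyIterate f 0 = X := rfl

theorem polyIterate_succ (f : ℤ[X]) (n : ℕ) : polyIterate f (n + 1) = f.comp (polyIterate f n) :=
  Function.iterate_succ_apply' _ _ _

theorem polyIterate_add (f : ℤ[X]) (m n : ℕ) :
    polyIterate f (m + n) = (polyIterate f m).comp (polyIterate f n) := by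
  induction m with
  | zero => simp [polyIterate_zero]
  | succ m ih => rw [Nat.add_right_comm, polyIterate_succ, ih, polyIterate_succ, comp_assoc]

theorem polyIterate_one (f : ℤ[X]) : polyIterate f 1 = f := by
  rw [polyIterate_succ, polyIterate_zero, comp_X]

theorem radicalPoly_monic {p : ℕ} (hp : p.Prime) (a : ℤ) : (radicalPoly p a).Monic :=
  monic_X_pow_sub_C a hp.ne_zero

theorem natDegree_polyIterate_radicalPoly (p : ℕ) (a : ℤ) (n : ℕ) :
    (polyIterate (radicalPoly p a) n).natDegree = p ^ n := by
  rw [polyIterate, natDegree_iterate_comp, radicalPoly, natDegree_X_pow_sub_C, natDegree_X, mul_one]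

theorem polyIterate_radicalPoly_monic {p : ℕ} (hp : p.Prime) (a : ℤ) (n : ℕ) :
    (polyIterate (radicalPoly p a) n).Monic := by
  induction n with
  | zero => exact monic_X
  | succ n ih =>
    rw [polyIterate_succ]
    refine (radicalPoly_monic hp a).comp ih ?_
    rw [natDegree_polyIterate_radicalPoly]
    exact pow_ne_zero _ hp.ne_zero

theorem comp_radicalPoly (p : ℕ) (a : ℤ) (g : ℤ[X]) : (radicalPoly p a).comp g = g ^ p - C a := by
  simp [radicalPoly]

/-- The innermost `f` makes the iterate a polynomial in `X^p`, and `p ≥ 2` excludes a linear term.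
-/
theorem exists_polyIterate_radicalPoly_eq {p : ℕ} (hp : p.Prime) (a : ℤ) {n : ℕ} (hn : 1 ≤ n) :
    ∃ H : ℤ[X], polyIterate (radicalPoly p a) n =
      C ((polyIterate (radicalPoly p a) n).eval 0) + X ^ 2 * H := by
  obtain ⟨n, rfl⟩ := Nat.exists_eq_add_of_le' hn
  obtain ⟨k, rfl⟩ := Nat.exists_eq_add_of_le' hp.two_le
  set P := (polyIterate (radicalPoly (k + 2) a) n).comp (X - C a) with hP
  have h1 : polyIterate (radicalPoly (k + 2) a) (n + 1) = P.comp (X ^ (k + 2)) := by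
    rw [polyIterate_add, polyIterate_one, hP, comp_assoc]
    simp [radicalPoly]
  refine ⟨X ^ k * P.divX.comp (X ^ (k + 2)), ?_⟩
  have h2 : (P.comp (X ^ (k + 2))).eval 0 = P.coeff 0 := by
    rw [eval_comp]; simp [coeff_zero_eq_eval_zero]
  rw [h1, h2]
  conv_lhs => rw [← divX_mul_X_add P]
  simp only [add_comp, mul_comp, X_comp, C_comp]
  ring

theorem zmod_pow_prime_pow (p : ℕ) [Fact p.Prime] (c : ZMod p) (n : ℕ) : c ^ p ^ n = c := by
  simp

theorem map_polyIterate_radicalPoly (p : ℕ) [Fact p.Prime] (a : ℤ) (n : ℕ) :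
    (polyIterate (radicalPoly p a) n).map (Int.castRingHom (ZMod p)) =
      (X - C ((n * a : ℤ) : ZMod p)) ^ p ^ n := by
  induction n with
  | zero => simp [polyIterate_zero]
  | succ n ih =>
    rw [polyIterate_succ, comp_radicalPoly, Polynomial.map_sub, Polynomial.map_pow, ih, map_C,
      ← pow_mul, ← pow_succ, sub_pow_char_pow, sub_pow_char_pow, ← C_pow, ← C_pow,
      zmod_pow_prime_pow, zmod_pow_prime_pow, sub_sub, ← C_add]
    congr 2
    push_cast
    simp only [eq_intCast]
    ring

theorem dvd_eval_polyIterate_radicalPoly_sub {p : ℕ} (hp : p.Prime) (a : ℤ) (n : ℕ) (c : ℤ) :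
    (p : ℤ) ∣ (polyIterate (radicalPoly p a) n).eval c - (c - n * a) := by
  have : Fact p.Prime := ⟨hp⟩
  rw [← ZMod.intCast_zmod_eq_zero_iff_dvd]
  have h1 := congrArg (eval (c : ZMod p)) (map_polyIterate_radicalPoly p a n)
  rw [eval_intCast_map, Int.cast_id, eval_pow, zmod_pow_prime_pow] at h1
  push_cast
  simp only [eval_sub, eval_X, eval_C, eq_intCast, Int.cast_mul, Int.cast_natCast] at h1
  rw [h1, sub_self]

/-- Modulo `p` each `f` shifts by `-a`, so `f^n((n+1)a) ≡ a`; a `p`-th power lifts this to `p²`.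
This is the Eisenstein remainder. -/
theorem sq_dvd_eval_polyIterate_radicalPoly_sub {p : ℕ} (hp : p.Prime) (a : ℤ) (n : ℕ) :
    (p : ℤ) ^ 2 ∣ (polyIterate (radicalPoly p a) (n + 1)).eval ((n + 1 : ℕ) * a : ℤ) -
      (a ^ p - a) := by
  have h1 := dvd_eval_polyIterate_radicalPoly_sub hp a n ((n + 1 : ℕ) * a : ℤ)
  have h2 : (((n + 1 : ℕ) : ℤ) * a - n * a) = a := by push_cast; ring
  rw [h2] at h1
  have h3 := dvd_sub_pow_of_dvd_sub h1 1
  rw [pow_one] at h3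
  rw [polyIterate_succ, comp_radicalPoly, eval_sub, eval_pow, eval_C, sub_sub_sub_cancel_right]
  exact h3

/-- If `a ^ p ≢ a` modulo `p ^ 2`, then all iterates of `x ^ p - a` are irreducible, by
Eisenstein's criterion at `p`. -/
theorem irreducible_polyIterate_radicalPoly {p : ℕ} (hp : p.Prime) {a : ℤ}
    (ha : ¬ a ^ p ≡ a [ZMOD (p : ℤ) ^ 2]) {n : ℕ} (hn : 1 ≤ n) :
    Irreducible (polyIterate (radicalPoly p a) n) := by
  obtain ⟨n, rfl⟩ := Nat.exists_eq_add_of_le' hn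
  have : Fact p.Prime := ⟨hp⟩
  have hmon := polyIterate_radicalPoly_monic hp a (n + 1)
  refine generalizedEisenstein (K := ZMod p) (q := X - C ((n + 1 : ℕ) * a : ℤ)) (p := p ^ (n + 1))
    ?_ (monic_X_sub_C _) hmon.isPrimitive ?_ ?_ ?_ ?_
  · rw [Polynomial.map_sub, map_X, map_C]
    exact irreducible_X_sub_C _
  · rw [natDegree_polyIterate_radicalPoly]
    exact pow_pos hp.pos _
  · simp [hmon.leadingCoeff]
  · rw [hmon.leadingCoeff, map_one, C_1, one_mul]
    have := map_polyIterate_radicalPoly p a (n + 1)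
    rw [algebraMap_int_eq, this, Polynomial.map_sub, map_X, map_C]
    rfl
  · rw [modByMonic_X_sub_C_eq_C_eval, map_C, Ne, C_eq_zero, Ideal.Quotient.eq_zero_iff_mem,
      algebraMap_int_eq, ZMod.ker_intCastRingHom, Ideal.span_singleton_pow,
      Ideal.mem_span_singleton]
    intro h
    apply ha
    refine (Int.modEq_iff_dvd.2 ?_).symm
    exact ((dvd_sub_right h).1 (sq_dvd_eval_polyIterate_radicalPoly_sub hp a n))

/-- Chain rule: `(f^(n+1))' = p (f^n)^(p-1) (f^n)'`. -/
theorem exists_aeval_polyIterate_mem {A : Type*} [CommRing A] {p : ℕ} {a : ℤ} {m : Ideal A}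
    [m.IsPrime] (hpm : (p : A) ∉ m) (α : A) (n : ℕ)
    (h : aeval α (derivative (polyIterate (radicalPoly p a) n)) ∈ m) :
    ∃ i < n, aeval α (polyIterate (radicalPoly p a) i) ∈ m := by
  induction n with
  | zero =>
    rw [polyIterate_zero, derivative_X, map_one] at h
    exact absurd (m.eq_top_of_isUnit_mem h isUnit_one) (Ideal.IsPrime.ne_top ‹_›)
  | succ n ih =>
    rw [polyIterate_succ, comp_radicalPoly, derivative_sub, derivative_C, sub_zero, derivative_pow,
      map_mul, map_mul, aeval_C, map_pow] at h
    rcases Ideal.IsPrime.mem_or_mem ‹_› h with h | h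
    · rcases Ideal.IsPrime.mem_or_mem ‹_› h with h | h
      · exact absurd (by simpa using h) hpm
      · exact ⟨n, n.lt_succ_self, Ideal.IsPrime.mem_of_pow_mem ‹_› _ h⟩
    · obtain ⟨i, hi, h⟩ := ih h
      exact ⟨i, hi.trans n.lt_succ_self, h⟩

/-! ### Necessity of the two conditions -/

/-- With `f^n = m²c + X²H`, the element `β = xH(x)/m` satisfies `β² = -cH(x)`. -/
theorem not_isMonogenerator_of_sq_dvd {L : Type*} [Field L] [CharZero L] {p : ℕ} (hp : p.Prime)
    {a : ℤ} {x : L} {n : ℕ} (hn : 1 ≤ n) (hirr : Irreducible (polyIterate (radicalPoly p a) n))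
    (hx : aeval x (polyIterate (radicalPoly p a) n) = 0) {m : ℤ} (hm : ¬ IsUnit m)
    (hdvd : m * m ∣ (polyIterate (radicalPoly p a) n).eval 0) : ¬ IsMonogenerator x := by
  obtain ⟨H, hH⟩ := exists_polyIterate_radicalPoly_eq hp a hn
  obtain ⟨c, hc⟩ := hdvd
  have hmon := polyIterate_radicalPoly_monic hp a n
  have hdeg : 0 < (polyIterate (radicalPoly p a) n).natDegree := by
    rw [natDegree_polyIterate_radicalPoly]; exact pow_pos hp.pos _
  generalize polyIterate (radicalPoly p a) n = F at *
  have hX2 : X ^ 2 * H = F - C (F.eval 0) := by rw [eq_sub_iff_add_eq, add_comm]; exact hH.symm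
  have hHmon : H.Monic := by
    refine Monic.of_mul_monic_left (monic_X_pow 2) ?_
    rw [hX2]
    exact hmon.sub_of_left (degree_C_le.trans_lt (natDegree_pos_iff_degree_pos.1 hdeg))
  have hFd : F.natDegree = 2 + H.natDegree := by
    rw [← natDegree_sub_C (a := F.eval 0), ← hX2, (monic_X_pow 2).natDegree_mul hHmon,
      natDegree_X_pow]
  refine not_isMonogenerator_of_quadratic (b := X * H) (u := 0) (v := -(C c * H)) hmon hirr hx
    (monic_X.mul hHmon) ?_ hm ?_
  · apply degree_lt_degree
    rw [monic_X.natDegree_mul hHmon, natDegree_X, hFd]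
    omega
  · have h1 : (X * H) ^ 2 = (F - C (F.eval 0)) * H := by rw [← hX2]; ring
    rw [h1, hc, map_mul, map_sub, hx]
    simp only [map_mul, map_add, map_neg, map_pow, map_zero]
    ring

/-- The integral element is `β = (x-a)^(p-1)/p`, with `β² = -a r β - c(x-a)^(p-2)`. -/
theorem not_isMonogenerator_of_modEq {L : Type*} [Field L] [CharZero L] {p : ℕ} (hp : p.Prime)
    {a : ℤ} {x : L} (hirr : Irreducible (radicalPoly p a)) (hx : aeval x (radicalPoly p a) = 0)
    (h : a ^ p ≡ a [ZMOD (p : ℤ) ^ 2]) : ¬ IsMonogenerator x := by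
  obtain ⟨c, hc⟩ := h.symm.dvd
  have hmon := radicalPoly_monic hp a
  have hpu : ¬ IsUnit (p : ℤ) := (Nat.prime_iff_prime_int.1 hp).not_isUnit
  obtain ⟨r, hr⟩ := exists_add_pow_prime_eq hp (X - C a) (C a)
  rw [sub_add_cancel] at hr
  have hc' : (C a ^ p - C a : ℤ[X]) = C (p : ℤ) ^ 2 * C c := by
    rw [← C_pow, ← C_sub, hc, C_mul, C_pow]
  have hF : (X - C a) ^ p = radicalPoly p a - C (p : ℤ) * (X - C a) * C a * r -
      C (p : ℤ) ^ 2 * C c := by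
    rw [radicalPoly, hr, ← hc']
    simp
    ring
  have hdeg : (radicalPoly p a).natDegree = p := natDegree_X_pow_sub_C
  refine not_isMonogenerator_of_quadratic (b := (X - C a) ^ (p - 1)) (m := p) (u := -(C a * r))
    (v := -(C c * (X - C a) ^ (p - 2))) hmon hirr hx ((monic_X_sub_C a).pow _) ?_ hpu ?_
  · apply degree_lt_degree
    rw [hdeg, (monic_X_sub_C a).natDegree_pow, natDegree_X_sub_C]
    have := hp.pos
    omega
  · obtain ⟨k, rfl⟩ := Nat.exists_eq_add_of_le' hp.two_le
    have h1 : ((X - C a) ^ (k + 2 - 1)) ^ 2 = (X - C a) ^ k * (X - C a) ^ (k + 2) := by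
      rw [show k + 2 - 1 = k + 1 by omega]; ring
    rw [h1, hF, map_mul, map_sub, map_sub, hx]
    rw [show k + 2 - 1 = k + 1 by omega, show k + 2 - 2 = k by omega]
    simp only [map_mul, map_add, map_neg, map_pow, map_sub]
    ring

/-! ### Sufficiency and conclusion -/

theorem exists_notMem_mul_prime_mem_sq {A : Type*} [CommRing A] {p : ℕ} (hp : p.Prime) {a : ℤ}
    (ha : ¬ a ^ p ≡ a [ZMOD (p : ℤ) ^ 2]) {m : Ideal A} [m.IsMaximal] (hpm : (p : A) ∈ m)
    (y : A) (hy : y ^ p = a) : ∃ s ∉ m, s * (p : A) ∈ m ^ 2 := by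
  have : Fact p.Prime := ⟨hp⟩
  have hne : m ≠ ⊤ := Ideal.IsPrime.ne_top inferInstance
  obtain ⟨u, hu⟩ : (p : ℤ) ∣ a ^ p - a := by
    rw [← ZMod.intCast_zmod_eq_zero_iff_dvd]
    simp
  have hpu : ¬ (p : ℤ) ∣ u := by
    rintro ⟨c, rfl⟩
    exact ha (Int.modEq_iff_dvd.2 ⟨c, by rw [hu]; ring⟩).symm
  have hum : (u : A) ∉ m := fun h => hpu (natCast_dvd_of_intCast_mem hne hp hpm h)
  obtain ⟨r, hr⟩ := exists_add_pow_prime_eq hp (y - a) (a : A)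
  rw [sub_add_cancel, hy] at hr
  have hu' : (a : A) ^ p - a = p * u := by exact_mod_cast congrArg (Int.cast : ℤ → A) hu
  have hη : (y - a) ^ p = -(p * (u + (y - a) * a * r)) := by
    linear_combination -hr - hu'
  have hηm : y - a ∈ m := by
    apply Ideal.IsPrime.mem_of_pow_mem (I := m) inferInstance p
    rw [hη]
    exact m.neg_mem (m.mul_mem_right _ hpm)
  -- This is the cofactor of `-p` in `(y-a)^p`; it is congruent to `u` modulo `m`.
  refine ⟨u + (y - a) * a * r, fun h => hum ?_, ?_⟩
  · refine (m.add_mem_iff_left ?_).1 h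
    exact m.mul_mem_right _ (m.mul_mem_right _ hηm)
  · have h1 : (u + (y - a) * a * r) * (p : A) = -(y - a) ^ p := by rw [hη]; ring
    rw [h1]
    exact (m ^ 2).neg_mem (Ideal.pow_le_pow_right hp.two_le (Ideal.pow_mem_pow hηm p))

theorem isIntegrallyClosed_of_squarefree {A : Type*} [CommRing A] [IsDomain A]
    [Algebra.IsIntegral ℤ A] {p : ℕ} (hp : p.Prime) {a : ℤ}
    (ha : ¬ a ^ p ≡ a [ZMOD (p : ℤ) ^ 2]) {n : ℕ} (hn : 1 ≤ n)
    (hsq : ∀ k, 1 ≤ k → k ≤ n → Squarefree ((polyIterate (radicalPoly p a) k).eval 0))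
    (α : A) (hα : Function.Surjective (aeval (R := ℤ) α))
    (hF : aeval α (polyIterate (radicalPoly p a) n) = 0) : IsIntegrallyClosed A := by
  refine isIntegrallyClosed_of_simple_root_or_mem_sq α hα _ hF fun m _ q hq hqm => ?_
  have hne : m ≠ ⊤ := Ideal.IsPrime.ne_top inferInstance
  by_cases hpq : q = p
  · subst hpq
    right
    obtain ⟨n, rfl⟩ := Nat.exists_eq_add_of_le' hn
    refine exists_notMem_mul_prime_mem_sq hp ha hqm (aeval α (polyIterate (radicalPoly q a) n)) ?_
    rw [polyIterate_succ, comp_radicalPoly, map_sub, map_pow, aeval_C, sub_eq_zero] at hF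
    simpa using hF
  rw [or_iff_not_imp_left, not_not]
  intro hder
  have hpm : (p : A) ∉ m := fun h => by
    have h1 : (q : ℤ) ∣ (p : ℤ) := natCast_dvd_of_intCast_mem hne hq hqm (by simpa using h)
    exact hpq ((Nat.prime_dvd_prime_iff_eq hq hp).1 (Int.natCast_dvd_natCast.1 h1))
  obtain ⟨i, hi, him⟩ := exists_aeval_polyIterate_mem hpm α n hder
  -- Split `f^n = f^k ∘ f^i`; with `γ = f^i(α) ∈ m`, `0 = f^k(γ) = f^k(0) + γ²H(γ)`.
  obtain ⟨k, rfl⟩ := Nat.exists_eq_add_of_le' hi.le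
  obtain ⟨H, hH⟩ := exists_polyIterate_radicalPoly_eq hp a (n := k) (by omega)
  have hk := hsq k (by omega) (by omega)
  rw [polyIterate_add, aeval_comp] at hF
  generalize aeval α (polyIterate (radicalPoly p a) i) = γ at *
  rw [hH] at hF
  simp only [map_add, map_mul, map_pow, aeval_X, eq_intCast, map_intCast] at hF
  generalize (polyIterate (radicalPoly p a) k).eval 0 = z at *
  have hz2 : (z : A) ∈ m ^ 2 := by
    rw [eq_neg_of_add_eq_zero_left hF]
    exact (m ^ 2).neg_mem (Ideal.mul_mem_right _ _ (Ideal.pow_mem_pow him 2))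
  obtain ⟨u, rfl⟩ := natCast_dvd_of_intCast_mem hne hq hqm (Ideal.pow_le_self two_ne_zero hz2)
  refine ⟨(u : A), fun h => ?_, by simpa [mul_comm] using hz2⟩
  obtain ⟨w, rfl⟩ := natCast_dvd_of_intCast_mem hne hq hqm h
  exact (Nat.prime_iff_prime_int.1 hq).not_isUnit (hk q ⟨w, by ring⟩)

theorem theorem1p1 {L : Type*} [Field L] [CharZero L] (p : ℕ) (hp : p.Prime) (a : ℤ)
    (hf : Irreducible (radicalPoly p a)) (N : ℕ) (hN : 1 ≤ N) (α : ℕ → L)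
    (hα : ∀ n, 1 ≤ n → n ≤ N → aeval (α n) (polyIterate (radicalPoly p a) n) = 0) :
    (∀ n, 1 ≤ n → n ≤ N → IsMonogenerator (α n)) ↔
      (¬ a ^ p ≡ a [ZMOD (p : ℤ) ^ 2] ∧
        ∀ n, 1 ≤ n → n ≤ N → Squarefree ((polyIterate (radicalPoly p a) n).eval 0)) := by
  constructor
  · intro h
    -- This must come first, from `n = 1`: irreducibility of the higher iterates rests on it.
    have ha : ¬ a ^ p ≡ a [ZMOD (p : ℤ) ^ 2] := fun hmod => by
      have h1 := hα 1 le_rfl hN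
      rw [polyIterate_one] at h1
      exact not_isMonogenerator_of_modEq hp hf h1 hmod (h 1 le_rfl hN)
    refine ⟨ha, fun n hn hnN m hm => ?_⟩
    by_contra hmu
    exact not_isMonogenerator_of_sq_dvd hp hn (irreducible_polyIterate_radicalPoly hp ha hn)
      (hα n hn hnN) hmu hm (h n hn hnN)
  · rintro ⟨ha, hsq⟩ n hn hnN
    have hint : IsIntegral ℤ (α n) := ⟨_, polyIterate_radicalPoly_monic hp a n, hα n hn hnN⟩
    refine isMonogenerator_of_isIntegrallyClosed (α n) hint ?_
    have := isIntegral_adjoin_gen (α n) hint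
    set g := AdjoinSimple.gen ℚ (α n) with hg
    have hval : ∀ G : ℤ[X], ((aeval (⟨g, Algebra.self_mem_adjoin_singleton ℤ g⟩ :
        Algebra.adjoin ℤ {g}) G : Algebra.adjoin ℤ {g}) : ℚ⟮α n⟯) = aeval g G := fun G =>
      (aeval_algebraMap_apply ℚ⟮α n⟯ (⟨g, Algebra.self_mem_adjoin_singleton ℤ g⟩ :
        Algebra.adjoin ℤ {g}) G).symm
    refine isIntegrallyClosed_of_squarefree hp ha hn (fun k hk hkn => hsq k hk (hkn.trans hnN))
      ⟨g, Algebra.self_mem_adjoin_singleton ℤ g⟩ ?_ ?_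
    · rintro ⟨y, hy⟩
      have hy' := hy
      rw [Algebra.adjoin_singleton_eq_range_aeval] at hy'
      obtain ⟨G, hG⟩ := hy'
      exact ⟨G, Subtype.ext ((hval G).trans hG)⟩
    · apply Subtype.ext
      rw [hval]
      apply (algebraMap ℚ⟮α n⟯ L).injective
      rw [← aeval_algebraMap_apply, hg, AdjoinSimple.algebraMap_gen, hα n hn hnN]
      simp
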